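/- Let $r\ge 1$, let $\mathbf m=(m_1,\dots,m_r)$ be positive integers, $m=m_1+\cdots+m_r$, let $a,b\in\mathbb C$ and $\mathbf f=(f_1,\dots,f_r)\in\mathbb C^r$ with $f_j\notin\{0,-1,-2,\dots\}$ for all $j$. Write $(z)_n=z(z+1)\cdots(z+n-1)$, $(\mathbf f)_{\mathbf m}=(f_1)_{m_1}\cdots(f_r)_{m_r}$, $\mathbf f+\mathbf m=(f_1+m_1,\dots,f_r+m_r)$, and $\mathbf f-b=(f_1-b,\dots,f_r-b)$ (similarly $\mathbf f-b-1$). Define $\sigma_j$ by $(f_1+x)_{m_1}\cdots(f_r+x)_{m_r}=\sum_{j=0}^m\sigma_jx^j$ and put $$C_{k,r}=\frac1{(\mathbf f)_{\mathbf m}}\sum_{j=k}^m\sigma_j\mathbf S_j^{(k)},\qquad R_1(t)=\sum_{k=0}^m(-1)^k(b)_kC_{k,r}(1-t-k),$$ where $\mathbf S_j^{(k)}$ are the Stirling numbers of the second kind. Suppose that $b+2\notin\{0,-1,-2,\dots\}$, that $f_j-b\notin\{2-m_j,3-m_j,\dots,0\}$ for every $j$ with $m_j\ge2$, and that $f_j-b-1+m_j\ne0$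 for every $j$, and let $$\lambda=1+b-\frac{b\prod_{j=1}^r(f_j-b-1)}{\prod_{j=1}^r(f_j-b-1+m_j)}.$$ Then $R_1$ is a polynomial of degree exactly $1$ and $\lambda$ is its only root. If, moreover, $\lambda+m-1\notin\{0,-1,-2,\dots\}$, then $$(1-x)^{a}\,{}_{r+2}F_{r+1}\!\left(\begin{matrix}a,b,\mathbf f+\mathbf m\\ b+2,\mathbf f\end{matrix}\,\middle|\,x\right)=\sum_{j=0}^{m-2}\frac{(a)_j}{(b+2)_j}\left(\frac{x}{x-1}\right)^j\sum_{k=0}^{j}(-1)^k(b)_k(j-k+1)C_{k,r}$$ $$+\frac{x^{m-1}(a)_{m-1}\bigl((b+m)(\mathbf f-b)_{\mathbf m}-b(\mathbf f-b-1)_{\mathbf m}\bigr)}{(x-1)^{m-1}(b+2)_{m-1}(\mathbf f)_{\mathbf m}}\;{}_3F_2\!\left(\begin{matrix}1,a+m-1,\lambda+m\\ b+m+1,\lambda+m-1\end{matrix}\,\middle|\,\frac{x}{x-1}\right)$$ for all $x\in\mathbb C\setminus[1,\infty)$, and $$e^{-x}\,{}_{r+1}F_{r+1}\!\left(\begin{matrix}b,\mathbf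 f+\mathbf m\\ b+2,\mathbf f\end{matrix}\,\middle|\,x\right)=\sum_{j=0}^{m-2}\frac{(-x)^j}{(b+2)_j}\sum_{k=0}^{j}(-1)^k(b)_k(j-k+1)C_{k,r}$$ $$+\frac{(-x)^{m-1}\bigl((b+m)(\mathbf f-b)_{\mathbf m}-b(\mathbf f-b-1)_{\mathbf m}\bigr)}{(b+2)_{m-1}(\mathbf f)_{\mathbf m}}\;{}_2F_2\!\left(\begin{matrix}1,\lambda+m\\ b+m+1,\lambda+m-1\end{matrix}\,\middle|\,-x\right)$$ for all $x\in\mathbb C$. Here empty sums are $0$, $(1-x)^a$ is the principal branch, and in the first identity ${}_{r+2}F_{r+1}$ and ${}_3F_2$ denote the analytic continuations of the hypergeometric series from the unit disc to $\mathbb C\setminus[1,\infty)$ (these continuations exist and are unique); in the second identity the series converge everywhere. -/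

import Mathlib

open scoped Nat

noncomputable section

namespace GenHyp

/-- The Pochhammer symbol `(a)_n = a (a + 1) ⋯ (a + n - 1)`. -/
def poch (a : ℂ) (n : ℕ) : ℂ := (ascPochhammer ℂ n).eval a

/-- The product `(f)_m = (f₁)_{m₁} ⋯ (f_r)_{m_r}`. -/
def vecPoch {r : ℕ} (f : Fin r → ℂ) (m : Fin r → ℕ) : ℂ := ∏ j, poch (f j) (m j)

/-- A finite vector of complex numbers as a list of hypergeometric parameters. -/
def params {r : ℕ} (f : Fin r → ℂ) : Multiset ℂ := Finset.univ.val.map f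

/-- The vector `f + m`. -/
def shift {r : ℕ} (f : Fin r → ℂ) (m : Fin r → ℕ) : Fin r → ℂ := fun j => f j + m j

/-- The `n`-th term of the generalized hypergeometric series with top parameters `A` and
bottom parameters `B`, i.e. `∏_{α ∈ A} (α)_n / (∏_{β ∈ B} (β)_n · n!) · z ^ n`. -/
def hypTerm (A B : Multiset ℂ) (z : ℂ) (n : ℕ) : ℂ :=
  (A.map (fun α => poch α n)).prod / ((B.map (fun β => poch β n)).prod * (n ! : ℂ)) * z ^ n

/-- The sum of the generalized hypergeometric series (where it converges). -/
def hypSum (A B : Multiset ℂ) (z : ℂ) : ℂ := ∑' n, hypTerm A B z n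

/-- The plane with the cut `[1, ∞)` removed. -/
def cutPlane : Set ℂ := ((fun t : ℝ => (t : ℂ)) '' Set.Ici 1)ᶜ

/-- `F` is an analytic continuation to `ℂ ∖ [1, ∞)` of the sum of the hypergeometric series
on the unit disc. -/
def IsContinuation (A B : Multiset ℂ) (F : ℂ → ℂ) : Prop :=
  DifferentiableOn ℂ F cutPlane ∧ ∀ z : ℂ, ‖z‖ < 1 → HasSum (hypTerm A B z) (F z)

/-- The generalized hypergeometric function on `ℂ ∖ [1, ∞)`: the analytic continuation of
the hypergeometric series. By `IsContinuation.eqOn` its values there do not depend on any choice,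
and by `hypCont_eq` it takes the values of the continuation as soon as there is one. -/
def hypCont (A B : Multiset ℂ) : ℂ → ℂ := Classical.epsilon (IsContinuation A B)

/-- The coefficients `σ_j` in `(f₁ + x)_{m₁} ⋯ (f_r + x)_{m_r} = ∑ σ_j x ^ j`. -/
def sigma {r : ℕ} (f : Fin r → ℂ) (m : Fin r → ℕ) (j : ℕ) : ℂ :=
  (∏ i, (ascPochhammer ℂ (m i)).comp (Polynomial.C (f i) + Polynomial.X)).coeff j

/-- The numbers `C_{k,r} = (1 / (f)_m) ∑_{j=k}^{m} σ_j S_j^{(k)}`, with `S_j^{(k)}` the Stirling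
numbers of the second kind and `m = m₁ + ⋯ + m_r`. -/
def coeffC {r : ℕ} (f : Fin r → ℂ) (m : Fin r → ℕ) (k : ℕ) : ℂ :=
  1 / vecPoch f m * ∑ j ∈ Finset.Icc k (∑ i, m i), sigma f m j * (Nat.stirlingSecond j k : ℂ)

/-- The reduced characteristic polynomial
`R_d(t) = ∑_{k=0}^{m} (b)_k C_{k,r} (-1)^k (1 - t - k)_d`, where `m = m₁ + ⋯ + m_r`. -/
def reducedPoly {r : ℕ} (b : ℂ) (f : Fin r → ℂ) (m : Fin r → ℕ) (d : ℕ) : Polynomial ℂ :=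
  ∑ k ∈ Finset.range (∑ i, m i + 1),
    Polynomial.C (poch b k * coeffC f m k * (-1) ^ k) *
      (ascPochhammer ℂ d).comp (1 - Polynomial.X - Polynomial.C (k : ℂ))

theorem mem_cutPlane_iff (z : ℂ) : z ∈ cutPlane ↔ 1 - z ∈ Complex.slitPlane := by
  rw [Complex.mem_slitPlane_iff_not_le_zero, cutPlane, Set.mem_compl_iff, not_iff_not]
  constructor
  · rintro ⟨t, ht, rfl⟩
    rw [Complex.le_def]
    simpa using ht
  · intro h
    rw [Complex.le_def] at h
    simp only [Complex.sub_re, Complex.one_re, Complex.zero_re, Complex.sub_im, Complex.one_im,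
      Complex.zero_im, zero_sub, neg_eq_zero] at h
    exact ⟨z.re, by simpa using h.1, Complex.ext (by simp) (by simp [h.2])⟩

/-- The analytic continuation to the cut plane is unique. -/
theorem IsContinuation.eqOn {A B : Multiset ℂ} {F G : ℂ → ℂ}
    (hF : IsContinuation A B F) (hG : IsContinuation A B G) : Set.EqOn F G cutPlane := by
  have hpre : cutPlane = (fun z : ℂ => 1 - z) ⁻¹' Complex.slitPlane :=
    Set.ext mem_cutPlane_iff
  have hopen : IsOpen cutPlane := by
    rw [hpre]
    exact Complex.isOpen_slitPlane.preimage (by fun_prop)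
  have himg : cutPlane = (fun z : ℂ => 1 - z) '' Complex.slitPlane := by
    rw [hpre]
    ext z
    constructor
    · intro h
      exact ⟨1 - z, h, by simp⟩
    · rintro ⟨w, hw, rfl⟩
      simpa using hw
  have hconn : IsPreconnected cutPlane := by
    rw [himg]
    refine IsPreconnected.image ?_ _ (by fun_prop)
    exact (Complex.starConvex_one_slitPlane.isPathConnected (by simp)).isConnected.isPreconnected
  refine (hF.1.analyticOnNhd hopen).eqOn_of_preconnected_of_eventuallyEq
    (hG.1.analyticOnNhd hopen) hconn (z₀ := 0) ?_ ?_
  · rw [mem_cutPlane_iff]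
    simp
  · filter_upwards [Metric.ball_mem_nhds (0 : ℂ) one_pos] with z hz
    have hz' : ‖z‖ < 1 := by simpa using hz
    exact (hF.2 z hz').unique (hG.2 z hz')

theorem hypCont_eq {A B : Multiset ℂ} {F : ℂ → ℂ} (hF : IsContinuation A B F) :
    Set.EqOn (hypCont A B) F cutPlane :=
  IsContinuation.eqOn (Classical.epsilon_spec (p := IsContinuation A B) ⟨F, hF⟩) hF

end GenHyp

end

noncomputable section

namespace GenHyp

/-! Since `(f)_m (f+m)_n` and `(f)_n (f+n)_m` both equal `(f)_{m+n}` factor by factor, the left-hand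
series have terms `(a)_n/n! · c_n x^n` and `c_n x^n/n!`, where `c_n = (b)_n/(b+2)_n ·
(f+n)_m/(f)_m`. Pfaff's substitution `x/(x-1)` with the prefactor `(1-x)^a`, and Kummer's
multiplication by `exp(-x)`, both replace `c` by its binomial transform `∑ (-1)^n (j choose n) c_n`.
Both identities therefore rest on evaluating this transform.

The `C_{k,r}` are the Newton coefficients of `(f+x)_m/(f)_m` in falling factorials
(`sum_coeffC_mul_fallFac`). At `x = n` this expansion reduces the transform to Chu–Vandermonde sums
and gives `j!/(b+2)_j · ∑_{k≤j} (-1)^k (b)_k (j-k+1) C_{k,r}` (`sum_choose_mul_coeff`). At `x = -b`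
and `x = -b-1` it evaluates `R_1` in closed form: leading coefficient `-(f-b)_m/(f)_m`, root `λ`
(`reducedPoly_one_eq`). For `j ≥ m-1` the inner sum is the full sum `R_1(-j)`, hence proportional to
`λ+j`. This produces the ratio `(λ+m)_i/(λ+m-1)_i` of the tail (`innerSum_add`); the smaller `j`
give the finite sum.

The continuations are built from `(1-z)^(-a)` by operations on holomorphic functions on the cut
plane that act simply on Taylor coefficients: `z d/dz`, the averages `∫₀¹ t^s H(tz) dt`, and Pfaff's
substitution. Equality of Taylor coefficients then gives equality on the whole cut plane. -/

/-! ### Pochhammer symbols and Chu–Vandermonde -/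

@[simp] theorem poch_zero (a : ℂ) : poch a 0 = 1 := by simp [poch]

theorem poch_succ (a : ℂ) (n : ℕ) : poch a (n + 1) = poch a n * (a + n) := by
  simp [poch, ascPochhammer_succ_eval]

theorem poch_add (a : ℂ) (n k : ℕ) : poch a (n + k) = poch a n * poch (a + n) k := by
  induction k with
  | zero => simp
  | succ k ih =>
    rw [← add_assoc, poch_succ, ih, poch_succ]
    push_cast
    ring

theorem poch_succ_left (a : ℂ) (n : ℕ) : poch a (n + 1) = a * poch (a + 1) n := by
  rw [add_comm, poch_add, poch_succ]
  simp

theorem poch_ne_zero_of_lt {a : ℂ} {n : ℕ} (h : ∀ i < n, a ≠ -(i : ℂ)) : poch a n ≠ 0 := by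
  induction n with
  | zero => simp
  | succ n ih =>
    rw [poch_succ]
    exact mul_ne_zero (ih fun i hi => h i (hi.trans n.lt_succ_self)) fun h0 =>
      h n n.lt_succ_self (eq_neg_of_add_eq_zero_left h0)

theorem poch_ne_zero {a : ℂ} (h : ∀ n : ℕ, a ≠ -(n : ℂ)) (n : ℕ) : poch a n ≠ 0 :=
  poch_ne_zero_of_lt fun i _ => h i

theorem poch_one (n : ℕ) : poch 1 n = (n ! : ℂ) := by
  induction n with
  | zero => simp
  | succ n ih =>
    rw [poch_succ, ih, Nat.factorial_succ]
    push_cast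
    ring

theorem poch_two (n : ℕ) : poch 2 n = ((n + 1)! : ℂ) := by
  rw [← poch_one, poch_succ_left]
  norm_num

theorem poch_add_one_mul (a : ℂ) (n : ℕ) : poch (a + 1) n * a = poch a n * (a + n) := by
  rw [← poch_succ, poch_succ_left, mul_comm]

/-- A terminating form of the Chu–Vandermonde identity. -/
theorem sum_choose_mul_poch_div (j : ℕ) (b c : ℂ) (hc : ∀ n : ℕ, c ≠ -(n : ℂ)) :
    ∑ i ∈ Finset.range (j + 1), (-1) ^ i * (j.choose i : ℂ) * (poch b i / poch c i) =
      poch (c - b) j / poch c j := by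
  induction j generalizing b c with
  | zero => simp
  | succ j ih =>
    have hc1 : ∀ n : ℕ, c + 1 ≠ -(n : ℂ) := fun n h => hc (n + 1) (by
      push_cast
      linear_combination h)
    have hc0 : c ≠ 0 := by simpa using hc 0
    have hcj : c + j ≠ 0 := fun h => hc j (eq_neg_of_add_eq_zero_left h)
    -- Pascal's rule splits the sum; the shifted half is again a sum of the same type, with `b` and
    -- `c` raised by one.
    have key : ∑ i ∈ Finset.range (j + 2),
        (-1) ^ i * ((j + 1).choose i : ℂ) * (poch b i / poch c i) =
        ∑ i ∈ Finset.range (j + 1), (-1) ^ i * (j.choose i : ℂ) * (poch b i / poch c i)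
        - b / c * ∑ i ∈ Finset.range (j + 1),
          (-1) ^ i * (j.choose i : ℂ) * (poch (b + 1) i / poch (c + 1) i) := by
      rw [Finset.sum_range_succ' _ (j + 1)]
      have h1 : ∑ i ∈ Finset.range (j + 1), (-1) ^ i * (j.choose i : ℂ) * (poch b i / poch c i) =
          ∑ i ∈ Finset.range (j + 1),
            (-1) ^ (i + 1) * (j.choose (i + 1) : ℂ) * (poch b (i + 1) / poch c (i + 1)) + 1 := by
        rw [Finset.sum_range_succ' _ j, Finset.sum_range_succ _ j]
        simp
      rw [h1, Finset.mul_sum, add_sub_right_comm, ← Finset.sum_sub_distrib]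
      congr 1
      · refine Finset.sum_congr rfl fun i _ => ?_
        rw [Nat.choose_succ_succ, poch_succ_left b, poch_succ_left c, pow_succ]
        have := poch_ne_zero hc1 i
        field_simp
        push_cast
        ring
      · simp
    rw [key, ih b c hc, ih (b + 1) (c + 1) hc1, show c + 1 - (b + 1) = c - b by ring, poch_succ,
      poch_succ]
    have h1 := poch_ne_zero hc j
    have h2 := poch_ne_zero hc1 j
    have h3 := poch_add_one_mul c j
    rw [div_mul_div_comm, div_sub_div _ _ h1 (mul_ne_zero hc0 h2),
      div_eq_div_iff (mul_ne_zero h1 (mul_ne_zero hc0 h2)) (mul_ne_zero h1 hcj)]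
    linear_combination poch (c - b) j * poch c j * b * h3

/-! ### Falling factorials and Stirling numbers -/

/-- The falling factorial `x (x - 1) ⋯ (x - k + 1)`. -/
def fallFac (x : ℂ) (k : ℕ) : ℂ := (-1) ^ k * poch (-x) k

@[simp] theorem fallFac_zero (x : ℂ) : fallFac x 0 = 1 := by simp [fallFac]

theorem fallFac_succ (x : ℂ) (k : ℕ) : fallFac x (k + 1) = fallFac x k * (x - k) := by
  rw [fallFac, fallFac, poch_succ, pow_succ]
  ring

/-- Turns the weight `k` in `R_1` into a backward difference; at `x = -b` this is where the point
`-b-1` comes from. -/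
theorem mul_fallFac (x : ℂ) (k : ℕ) :
    (k : ℂ) * fallFac x k = x * (fallFac x k - fallFac (x - 1) k) := by
  have h := poch_add_one_mul (-x) k
  rw [fallFac, fallFac, show -(x - 1) = -x + 1 by ring]
  linear_combination -(-1) ^ k * h

theorem fallFac_natCast (n k : ℕ) : fallFac n k = (n.descFactorial k : ℂ) := by
  induction k with
  | zero => simp
  | succ k ih =>
    rw [fallFac_succ, ih, Nat.descFactorial_succ]
    push_cast
    rcases le_or_gt k n with h | h
    · rw [Nat.cast_sub h]
      ring
    · simp [Nat.descFactorial_of_lt h]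

theorem pow_eq_sum_stirling (x : ℂ) (j N : ℕ) (h : j ≤ N) :
    x ^ j = ∑ k ∈ Finset.range (N + 1), (Nat.stirlingSecond j k : ℂ) * fallFac x k := by
  suffices H : x ^ j = ∑ k ∈ Finset.range (j + 1), (Nat.stirlingSecond j k : ℂ) * fallFac x k by
    rw [H]
    refine Finset.sum_subset (Finset.range_mono (by omega)) fun k _ hk => ?_
    rw [Nat.stirlingSecond_eq_zero_of_lt (by simpa using hk)]
    simp
  clear h
  induction j with
  | zero => simp [Nat.stirlingSecond_zero]
  | succ j ih =>
    have e : ∀ k : ℕ, (Nat.stirlingSecond (j + 1) (k + 1) : ℂ) * fallFac x (k + 1) =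
        ((k + 1 : ℕ) : ℂ) * Nat.stirlingSecond j (k + 1) * fallFac x (k + 1) +
        Nat.stirlingSecond j k * fallFac x k * (x - k) := by
      intro k
      rw [Nat.stirlingSecond_succ_succ, fallFac_succ]
      push_cast
      ring
    rw [Finset.sum_range_succ', Nat.stirlingSecond_succ_zero, Finset.sum_congr rfl fun k _ => e k,
      Finset.sum_add_distrib, pow_succ, ih, Finset.sum_mul]
    have h1 : ∑ k ∈ Finset.range (j + 1),
        ((k + 1 : ℕ) : ℂ) * Nat.stirlingSecond j (k + 1) * fallFac x (k + 1) =
        ∑ k ∈ Finset.range (j + 1), (k : ℂ) * Nat.stirlingSecond j k * fallFac x k := by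
      rw [Finset.sum_range_succ, Finset.sum_range_succ' _ j,
        Nat.stirlingSecond_eq_zero_of_lt (Nat.lt_succ_self j)]
      simp
    rw [h1, Nat.cast_zero, zero_mul, add_zero, ← Finset.sum_add_distrib]
    refine Finset.sum_congr rfl fun k _ => ?_
    ring

/-! ### Newton expansion, the polynomial `R_1` and the binomial transform -/

section Parameters

variable {r : ℕ} (b : ℂ) (f : Fin r → ℂ) (m : Fin r → ℕ)

theorem vecPoch_add_eq_sum (x : ℂ) :
    vecPoch (fun j => f j + x) m =
      ∑ j ∈ Finset.range (∑ i, m i + 1), sigma f m j * x ^ j := by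
  set p : Polynomial ℂ :=
    ∏ i, (ascPochhammer ℂ (m i)).comp (Polynomial.C (f i) + Polynomial.X) with hp
  have hdeg : p.natDegree ≤ ∑ i, m i := by
    refine (Polynomial.natDegree_prod_le _ _).trans (Finset.sum_le_sum fun i _ => ?_)
    rw [Polynomial.natDegree_comp, ascPochhammer_natDegree, add_comm, Polynomial.natDegree_X_add_C,
      mul_one]
  have h1 : vecPoch (fun j => f j + x) m = p.eval x := by
    simp [hp, vecPoch, poch, Polynomial.eval_prod]
  rw [h1, Polynomial.eval_eq_sum_range' (Nat.lt_succ_of_le hdeg)]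
  rfl

/-- The numbers `C_{k,r}` are the Newton coefficients of `(f + x)_m / (f)_m`. -/
theorem sum_coeffC_mul_fallFac (x : ℂ) :
    ∑ k ∈ Finset.range (∑ i, m i + 1), coeffC f m k * fallFac x k =
      vecPoch (fun j => f j + x) m / vecPoch f m := by
  rw [vecPoch_add_eq_sum]
  have h : ∀ j ∈ Finset.range (∑ i, m i + 1), sigma f m j * x ^ j =
      ∑ k ∈ Finset.range (∑ i, m i + 1),
        sigma f m j * (Nat.stirlingSecond j k : ℂ) * fallFac x k := by
    intro j hj
    rw [pow_eq_sum_stirling x j _ (by simpa [Nat.lt_succ_iff] using hj), Finset.mul_sum]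
    simp only [mul_assoc]
  rw [Finset.sum_congr rfl h, Finset.sum_comm, Finset.sum_div]
  refine Finset.sum_congr rfl fun k _ => ?_
  have h2 : ∑ j ∈ Finset.Icc k (∑ i, m i), sigma f m j * (Nat.stirlingSecond j k : ℂ) =
      ∑ j ∈ Finset.range (∑ i, m i + 1), sigma f m j * (Nat.stirlingSecond j k : ℂ) := by
    refine Finset.sum_subset (fun j hj => ?_) fun j _ hj' => ?_
    · simp only [Finset.mem_Icc, Finset.mem_range] at *
      omega
    · rw [Nat.stirlingSecond_eq_zero_of_lt, Nat.cast_zero, mul_zero]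
      simp only [Finset.mem_Icc, Finset.mem_range] at *
      omega
  rw [coeffC, h2, ← Finset.sum_mul]
  ring

theorem neg_one_pow_mul_poch (k : ℕ) : (-1) ^ k * poch b k = fallFac (-b) k := by
  rw [fallFac, neg_neg]

/-- The reduced characteristic polynomial of degree one as an explicit linear function. -/
theorem sum_coeffC_mul_linear (t : ℂ) :
    ∑ k ∈ Finset.range (∑ i, m i + 1), (-1) ^ k * poch b k * (1 - t - k) * coeffC f m k =
      ((1 - t + b) * vecPoch (fun j => f j - b) m - b * vecPoch (fun j => f j - b - 1) m) /
        vecPoch f m := by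
  have h1 := sum_coeffC_mul_fallFac f m (-b)
  have h2 := sum_coeffC_mul_fallFac f m (-b - 1)
  have e : ∀ k ∈ Finset.range (∑ i, m i + 1),
      (-1) ^ k * poch b k * (1 - t - k) * coeffC f m k =
      (1 - t + b) * (coeffC f m k * fallFac (-b) k) -
        b * (coeffC f m k * fallFac (-b - 1) k) := by
    intro k _
    rw [neg_one_pow_mul_poch]
    linear_combination (- coeffC f m k) * mul_fallFac (-b) k
  rw [Finset.sum_congr rfl e, Finset.sum_sub_distrib, ← Finset.mul_sum, ← Finset.mul_sum, h1, h2]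
  simp only [sub_eq_add_neg, ← add_assoc]
  ring

theorem eval_reducedPoly_one (t : ℂ) :
    (reducedPoly b f m 1).eval t =
      ((1 - t + b) * vecPoch (fun j => f j - b) m - b * vecPoch (fun j => f j - b - 1) m) /
        vecPoch f m := by
  rw [← sum_coeffC_mul_linear, reducedPoly, Polynomial.eval_finsetSum]
  refine Finset.sum_congr rfl fun k _ => ?_
  simp [ascPochhammer_one]
  ring

/-- The binomial transform of `(b)_n / (b + 2)_n · (f + n)_m / (f)_m`. -/
theorem sum_choose_mul_coeff (hb : ∀ n : ℕ, b + 2 ≠ -(n : ℂ)) (j : ℕ) :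
    ∑ n ∈ Finset.range (j + 1), (-1) ^ n * (j.choose n : ℂ) *
        (poch b n / poch (b + 2) n * (vecPoch (fun i => f i + n) m / vecPoch f m)) =
      (j ! : ℂ) / poch (b + 2) j * ∑ k ∈ Finset.range (∑ i, m i + 1),
        if k ≤ j then (-1) ^ k * poch b k * ((j : ℂ) - k + 1) * coeffC f m k else 0 := by
  have e : ∀ n ∈ Finset.range (j + 1), (-1) ^ n * (j.choose n : ℂ) *
        (poch b n / poch (b + 2) n * (vecPoch (fun i => f i + n) m / vecPoch f m)) =
      ∑ k ∈ Finset.range (∑ i, m i + 1), (-1) ^ n * (j.choose n : ℂ) *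
        (poch b n / poch (b + 2) n) * (coeffC f m k * fallFac n k) := by
    intro n _
    rw [← sum_coeffC_mul_fallFac, ← mul_assoc, Finset.mul_sum]
  rw [Finset.sum_congr rfl e, Finset.sum_comm, Finset.mul_sum]
  refine Finset.sum_congr rfl fun k _ => ?_
  split_ifs with hk
  · obtain ⟨l, rfl⟩ := Nat.exists_eq_add_of_le hk
    have hbk : ∀ n : ℕ, b + 2 + k ≠ -(n : ℂ) := fun n h => hb (n + k) (by
      push_cast
      linear_combination h)
    -- The falling factorial kills `n < k`. With `n = k + i` and `j = k + l`, what remains is a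
    -- Chu–Vandermonde sum whose parameters differ by 2, and `(2)_l = (l+1)!` supplies the weight
    -- `j-k+1`.
    have hV := sum_choose_mul_poch_div l (b + k) (b + 2 + k) hbk
    rw [show b + 2 + k - (b + k) = 2 by ring, poch_two] at hV
    rw [show k + l + 1 = k + (l + 1) by ring, Finset.sum_range_add]
    have hz : ∑ n ∈ Finset.range k, (-1) ^ n * ((k + l).choose n : ℂ) *
        (poch b n / poch (b + 2) n) * (coeffC f m k * fallFac n k) = 0 := by
      refine Finset.sum_eq_zero fun n hn => ?_
      rw [fallFac_natCast, Nat.descFactorial_of_lt (by simpa using hn)]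
      simp
    have e2 : ∀ i ∈ Finset.range (l + 1), (-1) ^ (k + i) * ((k + l).choose (k + i) : ℂ) *
        (poch b (k + i) / poch (b + 2) (k + i)) * (coeffC f m k * fallFac (k + i : ℕ) k) =
        (-1) ^ k * poch b k * coeffC f m k / poch (b + 2) k * ((k + l).descFactorial k : ℂ) *
        ((-1) ^ i * (l.choose i : ℂ) * (poch (b + k) i / poch (b + 2 + k) i)) := by
      intro i hi
      have hc : ((k + l).choose (k + i) : ℂ) * ((k + i).descFactorial k : ℂ) =
          ((k + l).descFactorial k : ℂ) * (l.choose i : ℂ) := by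
        have := Nat.choose_mul (n := k + l) (k := k + i) (s := k) (by omega)
        simp only [Nat.add_sub_cancel_left] at this
        rw [Nat.descFactorial_eq_factorial_mul_choose, Nat.descFactorial_eq_factorial_mul_choose]
        exact_mod_cast by linear_combination (k ! ) * this
      rw [fallFac_natCast, poch_add b, poch_add (b + 2), pow_add, mul_div_mul_comm]
      linear_combination (-1) ^ k * (-1) ^ i * (poch b k / poch (b + 2) k) *
        (poch (b + k) i / poch (b + 2 + k) i) * coeffC f m k * hc
    rw [hz, zero_add, Finset.sum_congr rfl e2, ← Finset.mul_sum, hV, poch_add (b + 2)]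
    have h1 := poch_ne_zero hb k
    have h2 := poch_ne_zero hbk l
    have h3 : ((k + l)! : ℂ) = l ! * ((k + l).descFactorial k : ℂ) := by
      rw [← Nat.cast_mul, ← Nat.factorial_mul_descFactorial (Nat.le_add_right k l),
        Nat.add_sub_cancel_left]
    rw [h3, Nat.factorial_succ]
    field_simp
    push_cast
    ring
  · rw [mul_zero]
    refine Finset.sum_eq_zero fun n hn => ?_
    rw [fallFac_natCast, Nat.descFactorial_of_lt (by simp only [Finset.mem_range] at hn; omega)]
    simp

end Parameters

/-! ### Geometry of the cut plane -/

theorem isOpen_cutPlane : IsOpen cutPlane := by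
  rw [show cutPlane = (fun z : ℂ => 1 - z) ⁻¹' Complex.slitPlane from Set.ext mem_cutPlane_iff]
  exact Complex.isOpen_slitPlane.preimage (by fun_prop)

theorem ball_subset_cutPlane : Metric.ball (0 : ℂ) 1 ⊆ cutPlane := by
  intro z hz
  rw [mem_cutPlane_iff, Complex.mem_slitPlane_iff]
  left
  have h1 : ‖z‖ < 1 := by simpa using hz
  have h2 := Complex.re_le_norm z
  simp only [Complex.sub_re, Complex.one_re]
  linarith

theorem zero_mem_cutPlane : (0 : ℂ) ∈ cutPlane := ball_subset_cutPlane (by simp)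

theorem cutPlane_mem_nhds_zero : cutPlane ∈ nhds (0 : ℂ) :=
  isOpen_cutPlane.mem_nhds zero_mem_cutPlane

theorem one_sub_ne_zero_of_mem {z : ℂ} (hz : z ∈ cutPlane) : 1 - z ≠ 0 :=
  Complex.slitPlane_ne_zero ((mem_cutPlane_iff z).1 hz)

theorem isPreconnected_cutPlane : IsPreconnected cutPlane := by
  have himg : cutPlane = (fun z : ℂ => 1 - z) '' Complex.slitPlane := by
    ext z
    rw [mem_cutPlane_iff]
    exact ⟨fun h => ⟨1 - z, h, by simp⟩, by rintro ⟨w, hw, rfl⟩; simpa using hw⟩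
  rw [himg]
  refine IsPreconnected.image ?_ _ (by fun_prop)
  exact (Complex.starConvex_one_slitPlane.isPathConnected (by simp)).isConnected.isPreconnected

/-- Star-shapedness about the origin, which makes the averages over `t z` with `0 ≤ t ≤ 1`
meaningful. -/
theorem smul_mem_cutPlane {z : ℂ} (hz : z ∈ cutPlane) {t : ℝ} (h0 : 0 ≤ t) (h1 : t ≤ 1) :
    (t : ℂ) * z ∈ cutPlane := by
  rw [mem_cutPlane_iff] at *
  have h := Complex.starConvex_one_slitPlane hz (sub_nonneg.2 h1) h0 (by ring)
  convert h using 1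
  simp only [Complex.real_smul, Complex.ofReal_sub, Complex.ofReal_one]
  ring

theorem one_sub_div_sub_one {z : ℂ} (hz : z ∈ cutPlane) : 1 - z / (z - 1) = (1 - z)⁻¹ := by
  have h := one_sub_ne_zero_of_mem hz
  have h' : z - 1 ≠ 0 := fun h0 => h (by linear_combination -h0)
  field_simp
  ring

theorem div_sub_one_mem {z : ℂ} (hz : z ∈ cutPlane) : z / (z - 1) ∈ cutPlane := by
  rw [mem_cutPlane_iff, one_sub_div_sub_one hz, Complex.mem_slitPlane_iff_arg]
  have h := (Complex.mem_slitPlane_iff_arg).1 ((mem_cutPlane_iff z).1 hz)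
  refine ⟨?_, inv_ne_zero h.2⟩
  rw [Complex.arg_inv, if_neg h.1]
  intro h1
  have := Complex.neg_pi_lt_arg (1 - z)
  linarith

theorem div_sub_one_invol {z : ℂ} (hz : z ∈ cutPlane) :
    z / (z - 1) / (z / (z - 1) - 1) = z := by
  have h := one_sub_ne_zero_of_mem hz
  have h' : z - 1 ≠ 0 := fun h0 => h (by linear_combination -h0)
  have h1 : z / (z - 1) - 1 = (z - 1)⁻¹ := by
    field_simp
    ring
  rw [h1]
  field_simp

/-! ### Calculus of Taylor coefficients on the cut plane -/

/-- `F` is holomorphic on the cut plane and has Taylor coefficients `u` at the origin. -/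
def HasExpansion (u : ℕ → ℂ) (F : ℂ → ℂ) : Prop :=
  DifferentiableOn ℂ F cutPlane ∧ ∀ z : ℂ, ‖z‖ < 1 → HasSum (fun n => u n * z ^ n) (F z)

/-- Together with `HasExpansion.unique`, this lets coefficients be read off from functional
identities on the cut plane. -/
theorem hasExpansion_taylor {F : ℂ → ℂ} (hF : DifferentiableOn ℂ F cutPlane) :
    HasExpansion (fun n => (n ! : ℂ)⁻¹ * iteratedDeriv n F 0) F := by
  refine ⟨hF, fun z hz => ?_⟩
  have h := Complex.hasSum_taylorSeries_on_ball (hF.mono ball_subset_cutPlane)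
    (z := z) (by simpa using hz)
  refine HasSum.congr_fun h fun n => ?_
  simp only [sub_zero, smul_eq_mul]
  ring

theorem HasExpansion.hasFPowerSeriesAt {u : ℕ → ℂ} {F : ℂ → ℂ} (h : HasExpansion u F) :
    HasFPowerSeriesAt F (FormalMultilinearSeries.ofScalars ℂ u) 0 := by
  rw [hasFPowerSeriesAt_iff]
  filter_upwards [Metric.ball_mem_nhds (0 : ℂ) one_pos] with z hz
  rw [zero_add]
  refine HasSum.congr_fun (h.2 z (by simpa using hz)) fun n => ?_
  rw [FormalMultilinearSeries.coeff_ofScalars, smul_eq_mul, mul_comm]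

theorem HasExpansion.unique {u v : ℕ → ℂ} {F : ℂ → ℂ} (hu : HasExpansion u F)
    (hv : HasExpansion v F) : u = v := by
  have h := hu.hasFPowerSeriesAt.eq_formalMultilinearSeries hv.hasFPowerSeriesAt
  funext n
  rw [← FormalMultilinearSeries.coeff_ofScalars (𝕜 := ℂ) (p := u),
    ← FormalMultilinearSeries.coeff_ofScalars (𝕜 := ℂ) (p := v), h]

theorem HasExpansion.coeff_eq {u : ℕ → ℂ} {F : ℂ → ℂ} (h : HasExpansion u F) (n : ℕ) :
    u n = (n ! : ℂ)⁻¹ * iteratedDeriv n F 0 :=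
  congrFun (h.unique (hasExpansion_taylor h.1)) n

theorem HasExpansion.apply_zero {u : ℕ → ℂ} {F : ℂ → ℂ} (h : HasExpansion u F) : F 0 = u 0 := by
  simp [h.coeff_eq 0]

theorem HasExpansion.eqOn {u : ℕ → ℂ} {F G : ℂ → ℂ} (hF : HasExpansion u F)
    (hG : HasExpansion u G) : Set.EqOn F G cutPlane := by
  refine (hF.1.analyticOnNhd isOpen_cutPlane).eqOn_of_preconnected_of_eventuallyEq
    (hG.1.analyticOnNhd isOpen_cutPlane) isPreconnected_cutPlane zero_mem_cutPlane ?_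
  filter_upwards [Metric.ball_mem_nhds (0 : ℂ) one_pos] with z hz
  have hz' : ‖z‖ < 1 := by simpa using hz
  exact (hF.2 z hz').unique (hG.2 z hz')

theorem HasExpansion.congr {u : ℕ → ℂ} {F G : ℂ → ℂ} (hF : HasExpansion u F)
    (h : Set.EqOn G F cutPlane) : HasExpansion u G :=
  ⟨hF.1.congr h, fun z hz => by
    rw [h (ball_subset_cutPlane (by simpa using hz))]
    exact hF.2 z hz⟩

theorem HasExpansion.congr_coeff {u v : ℕ → ℂ} {F : ℂ → ℂ} (hF : HasExpansion u F)
    (h : ∀ n, v n = u n) : HasExpansion v F := by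
  rwa [funext h]

theorem HasExpansion.add {u v : ℕ → ℂ} {F G : ℂ → ℂ} (hF : HasExpansion u F)
    (hG : HasExpansion v G) : HasExpansion (fun n => u n + v n) (fun z => F z + G z) :=
  ⟨hF.1.add hG.1, fun z hz => by simpa only [add_mul] using (hF.2 z hz).add (hG.2 z hz)⟩

theorem HasExpansion.const_mul {u : ℕ → ℂ} {F : ℂ → ℂ} (hF : HasExpansion u F) (c : ℂ) :
    HasExpansion (fun n => c * u n) (fun z => c * F z) :=
  ⟨hF.1.const_mul c, fun z hz => by simpa only [mul_assoc] using (hF.2 z hz).mul_left c⟩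

theorem hasExpansion_zero : HasExpansion (fun _ => 0) (fun _ => 0) :=
  ⟨differentiableOn_const 0, fun z _ => by simp⟩

theorem HasExpansion.sum {ι : Type*} (s : Finset ι) {u : ι → ℕ → ℂ} {F : ι → ℂ → ℂ}
    (h : ∀ i ∈ s, HasExpansion (u i) (F i)) :
    HasExpansion (fun n => ∑ i ∈ s, u i n) (fun z => ∑ i ∈ s, F i z) := by
  classical
  induction s using Finset.induction_on with
  | empty => simpa using hasExpansion_zero
  | insert i s hi ih =>
    simp only [Finset.sum_insert hi]
    exact (h i (Finset.mem_insert_self i s)).add (ih fun j hj => h j (Finset.mem_insert_of_mem hj))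

theorem HasExpansion.pow_mul {u : ℕ → ℂ} {F : ℂ → ℂ} (hF : HasExpansion u F) (N : ℕ) :
    HasExpansion (fun n => if N ≤ n then u (n - N) else 0) (fun z => z ^ N * F z) := by
  refine ⟨(differentiableOn_id.pow N).mul hF.1, fun z hz => ?_⟩
  rw [← (add_left_injective N).hasSum_iff]
  · refine HasSum.congr_fun ((hF.2 z hz).mul_left (z ^ N)) fun n => ?_
    simp [pow_add]
    ring
  · intro n hn
    refine mul_eq_zero_of_left (if_neg ?_) _
    intro h
    exact hn ⟨n - N, by simp [Nat.sub_add_cancel h]⟩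

theorem hasExpansion_pow (N : ℕ) :
    HasExpansion (fun n => if n = N then 1 else 0) (fun z => z ^ N) := by
  refine ⟨differentiableOn_id.pow N, fun z _ => ?_⟩
  refine HasSum.congr_fun (hasSum_ite_eq N (z ^ N)) fun n => ?_
  beta_reduce
  split_ifs with h
  · rw [h, one_mul]
  · rw [zero_mul]

theorem hasExpansion_polynomial (N : ℕ) (c : ℕ → ℂ) :
    HasExpansion (fun n => if n < N then c n else 0)
      (fun z => ∑ n ∈ Finset.range N, c n * z ^ n) := by
  convert HasExpansion.sum (Finset.range N) fun i _ => (hasExpansion_pow i).const_mul (c i)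
    using 2 with n
  simp

theorem HasExpansion.theta {u : ℕ → ℂ} {F : ℂ → ℂ} (hF : HasExpansion u F) :
    HasExpansion (fun n => n * u n) (fun z => z * deriv F z) := by
  have h := (hasExpansion_taylor (hF.1.deriv isOpen_cutPlane)).pow_mul 1
  convert h using 2 with n
  · rcases n with _ | n
    · simp
    · rw [if_pos (Nat.succ_le_succ (Nat.zero_le n)), Nat.add_sub_cancel, ← iteratedDeriv_succ',
        hF.coeff_eq (n + 1), Nat.factorial_succ]
      have : (n : ℂ) + 1 ≠ 0 := Nat.cast_add_one_ne_zero n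
      push_cast
      field_simp
  · rw [pow_one]

theorem HasExpansion.exists_eval_mul {u : ℕ → ℂ} {F : ℂ → ℂ} (hF : HasExpansion u F)
    (p : Polynomial ℂ) : ∃ G, HasExpansion (fun n => p.eval (n : ℂ) * u n) G := by
  induction p using Polynomial.induction_on' with
  | add p q hp hq =>
    obtain ⟨G, hG⟩ := hp
    obtain ⟨H, hH⟩ := hq
    exact ⟨_, (hG.add hH).congr_coeff fun n => by rw [Polynomial.eval_add, add_mul]⟩
  | monomial k c =>
    have h : ∃ G, HasExpansion (fun n => (n : ℂ) ^ k * u n) G := by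
      induction k with
      | zero => exact ⟨F, by simpa using hF⟩
      | succ k ih =>
        obtain ⟨G, hG⟩ := ih
        exact ⟨_, hG.theta.congr_coeff fun n => by rw [pow_succ', mul_assoc]⟩
    obtain ⟨G, hG⟩ := h
    exact ⟨_, (hG.const_mul c).congr_coeff fun n => by rw [Polynomial.eval_monomial, mul_assoc]⟩

theorem HasExpansion.exists_tail {u : ℕ → ℂ} {F : ℂ → ℂ} (hF : HasExpansion u F) (N : ℕ) :
    ∃ H, HasExpansion (fun n => u (n + N)) H ∧
      ∀ z, F z = ∑ n ∈ Finset.range N, u n * z ^ n + z ^ N * H z := by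
  induction N with
  | zero => exact ⟨F, by simpa using hF, by simp⟩
  | succ N ih =>
    obtain ⟨H, hH, hFH⟩ := ih
    have hd : DifferentiableOn ℂ (dslope H 0) cutPlane :=
      (Complex.differentiableOn_dslope cutPlane_mem_nhds_zero).2 hH.1
    have hz : ∀ z, H z = u N + z * dslope H 0 z := by
      intro z
      have := sub_smul_dslope H 0 z
      rw [hH.apply_zero, zero_add, sub_zero, smul_eq_mul] at this
      rw [this]
      ring
    have ht := hasExpansion_taylor hd
    have h1 := ((hasExpansion_pow 0).const_mul (u N)).add (ht.pow_mul 1)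
    have h2 := hH.unique (h1.congr fun z _ => by
      rw [hz z]
      simp)
    refine ⟨dslope H 0, ?_, fun z => ?_⟩
    · convert ht using 2 with n
      have := congrFun h2 (n + 1)
      simpa [add_assoc, add_comm 1 N] using this
    · rw [hFH z, hz z, Finset.sum_range_succ]
      ring

/-! ### Binomial series, averaging, Pfaff's transformation -/

theorem hasExpansion_binomial (a : ℂ) :
    HasExpansion (fun n => poch a n / (n ! : ℂ)) (fun z => (1 - z) ^ (-a)) := by
  have hd : ∀ z ∈ cutPlane, HasDerivAt (fun z : ℂ => (1 - z) ^ (-a))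
      (-a * (1 - z) ^ (-a - 1) * (-1)) z := by
    intro z hz
    have h1 : HasDerivAt (fun z : ℂ => 1 - z) (-1) z := by
      simpa using (hasDerivAt_id z).const_sub 1
    exact h1.cpow_const ((mem_cutPlane_iff z).1 hz)
  have hD : DifferentiableOn ℂ (fun z : ℂ => (1 - z) ^ (-a)) cutPlane := fun z hz =>
    (hd z hz).differentiableAt.differentiableWithinAt
  have h := hasExpansion_taylor hD
  set u : ℕ → ℂ := fun n => (n ! : ℂ)⁻¹ * iteratedDeriv n (fun z : ℂ => (1 - z) ^ (-a)) 0
  -- The equation `(1-z) F' = a F`, multiplied by `z` and written `θF = z θF + a z F` with `θ = z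
  -- d/dz`, gives the recursion for the coefficients.
  have e1 := (h.theta.pow_mul 1).add ((h.pow_mul 1).const_mul a)
  have e2 := h.theta.unique (e1.congr fun z hz => by
    have hz0 := one_sub_ne_zero_of_mem hz
    beta_reduce
    rw [(hd z hz).deriv, Complex.cpow_sub _ _ hz0, Complex.cpow_one]
    field_simp
    ring)
  have hrec : ∀ n : ℕ, ((n : ℂ) + 1) * u (n + 1) = (a + n) * u n := by
    intro n
    have := congrFun e2 (n + 1)
    simp only [Nat.le_add_left, if_true, Nat.add_sub_cancel] at this
    push_cast at this
    rw [this]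
    ring
  refine h.congr_coeff fun n => ?_
  induction n with
  | zero => simp [u]
  | succ n ih =>
    have h0 : (n : ℂ) + 1 ≠ 0 := Nat.cast_add_one_ne_zero n
    have hf : (n ! : ℂ) ≠ 0 := Nat.cast_ne_zero.2 n.factorial_ne_zero
    refine mul_left_cancel₀ h0 ?_
    rw [hrec n, ← ih, poch_succ, Nat.factorial_succ]
    push_cast
    field_simp

/-- The Mellin-type average `∫₀¹ t ^ s H(t z) dt` divides the Taylor coefficients by
`n + s + 1`. -/
theorem HasExpansion.integral {u : ℕ → ℂ} {H : ℂ → ℂ} (hH : HasExpansion u H) {s : ℂ}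
    (hs : 0 < s.re) :
    HasExpansion (fun n => u n / (n + s + 1))
      (fun z => ∫ t in (0 : ℝ)..1, (t : ℂ) ^ s * H (t * z)) := by
  have hc : Continuous fun t : ℝ => (t : ℂ) ^ s := Complex.continuous_ofReal_cpow_const hs
  have hbd : ∀ t ∈ Set.uIoc (0 : ℝ) 1, ‖(t : ℂ) ^ s‖ ≤ 1 := by
    intro t ht
    rw [Set.uIoc_of_le zero_le_one] at ht
    rw [Complex.norm_cpow_eq_rpow_re_of_pos ht.1]
    exact Real.rpow_le_one ht.1.le ht.2 hs.le
  have hcont : ∀ G : ℂ → ℂ, DifferentiableOn ℂ G cutPlane → ∀ z ∈ cutPlane,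
      ContinuousOn (fun t : ℝ => (t : ℂ) ^ s * G (t * z)) (Set.uIcc 0 1) := by
    intro G hG z hz
    refine hc.continuousOn.mul (hG.continuousOn.comp (by fun_prop) fun t ht => ?_)
    rw [Set.uIcc_of_le zero_le_one] at ht
    exact smul_mem_cutPlane hz ht.1 ht.2
  have hmeas : ∀ G : ℂ → ℂ, DifferentiableOn ℂ G cutPlane → ∀ z ∈ cutPlane,
      MeasureTheory.AEStronglyMeasurable (fun t : ℝ => (t : ℂ) ^ s * G (t * z))
        (MeasureTheory.volume.restrict (Set.uIoc 0 1)) := fun G hG z hz =>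
    ((hcont G hG z hz).mono Set.uIoc_subset_uIcc).aestronglyMeasurable measurableSet_uIoc
  have hH' : DifferentiableOn ℂ (deriv H) cutPlane := hH.1.deriv isOpen_cutPlane
  refine ⟨fun z hz => ?_, fun z hz => ?_⟩
  · obtain ⟨ε, hε, hball⟩ := Metric.nhds_basis_closedBall.mem_iff.1
      (isOpen_cutPlane.mem_nhds hz)
    have hK : IsCompact ((fun p : ℝ × ℂ => (p.1 : ℂ) * p.2) ''
        (Set.Icc (0 : ℝ) 1 ×ˢ Metric.closedBall z ε)) :=
      (isCompact_Icc.prod (isCompact_closedBall z ε)).image (by fun_prop)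
    have hKsub : (fun p : ℝ × ℂ => (p.1 : ℂ) * p.2) ''
        (Set.Icc (0 : ℝ) 1 ×ˢ Metric.closedBall z ε) ⊆ cutPlane := by
      rintro _ ⟨⟨t, w⟩, ⟨ht, hw⟩, rfl⟩
      exact smul_mem_cutPlane (hball hw) ht.1 ht.2
    obtain ⟨C, hC⟩ := hK.exists_bound_of_continuousOn (hH'.continuousOn.mono hKsub)
    have hder := intervalIntegral.hasDerivAt_integral_of_dominated_loc_of_deriv_le
      (μ := MeasureTheory.volume) (a := 0) (b := 1)
      (F := fun w (t : ℝ) => (t : ℂ) ^ s * H (t * w))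
      (F' := fun w (t : ℝ) => (t : ℂ) ^ s * (t * deriv H (t * w))) (x₀ := z)
      (s := Metric.closedBall z ε) (bound := fun _ => C)
      (Metric.closedBall_mem_nhds z hε)
      (by
        filter_upwards [isOpen_cutPlane.mem_nhds hz] with w hw
        exact hmeas H hH.1 w hw)
      (hcont H hH.1 z hz).intervalIntegrable
      (by
        have hm : ContinuousOn (fun t : ℝ => (t : ℂ) * ((t : ℂ) ^ s * deriv H (t * z)))
            (Set.uIcc 0 1) := Complex.continuous_ofReal.continuousOn.mul (hcont _ hH' z hz)
        refine ((hm.mono Set.uIoc_subset_uIcc).aestronglyMeasurable measurableSet_uIoc).congr ?_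
        exact Filter.Eventually.of_forall fun t => by ring)
      (by
        refine Filter.Eventually.of_forall fun t ht w hw => ?_
        have h1 := hbd t ht
        rw [Set.uIoc_of_le zero_le_one] at ht
        have h2 : ‖deriv H (t * w)‖ ≤ C := hC _ ⟨(t, w), ⟨⟨ht.1.le, ht.2⟩, hw⟩, rfl⟩
        have h3 : ‖(t : ℂ)‖ ≤ 1 := by
          rw [Complex.norm_real, Real.norm_of_nonneg ht.1.le]
          exact ht.2
        rw [norm_mul, norm_mul]
        calc _ ≤ 1 * (1 * C) := by gcongr
          _ = C := by ring)
      intervalIntegrable_const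
      (by
        refine Filter.Eventually.of_forall fun t ht w hw => ?_
        rw [Set.uIoc_of_le zero_le_one] at ht
        have hmem := smul_mem_cutPlane (hball hw) ht.1.le ht.2
        have h1 := (hH.1.differentiableAt (isOpen_cutPlane.mem_nhds hmem)).hasDerivAt
        have h2 : HasDerivAt (fun w : ℂ => (t : ℂ) * w) t w := by
          simpa using (hasDerivAt_id w).const_mul (t : ℂ)
        have h3 := (h1.comp w h2).const_mul ((t : ℂ) ^ s)
        rw [mul_comm (deriv H _)] at h3
        exact h3)
    exact hder.2.differentiableAt.differentiableWithinAt
  · have hzc : z ∈ cutPlane := ball_subset_cutPlane (by simpa using hz)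
    have hsum : Summable fun n => ‖u n * z ^ n‖ := (hH.2 z hz).summable.norm
    have h := intervalIntegral.hasSum_integral_of_dominated_convergence
      (μ := MeasureTheory.volume) (a := 0) (b := 1)
      (F := fun n (t : ℝ) => (t : ℂ) ^ s * (u n * (t * z) ^ n))
      (f := fun t : ℝ => (t : ℂ) ^ s * H (t * z))
      (fun n _ => ‖u n * z ^ n‖)
      (fun n => (by fun_prop : Continuous fun t : ℝ =>
        (t : ℂ) ^ s * (u n * (t * z) ^ n)).aestronglyMeasurable)
      (fun n => Filter.Eventually.of_forall fun t ht => by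
        have h1 := hbd t ht
        rw [Set.uIoc_of_le zero_le_one] at ht
        have h3 : ‖(t : ℂ) ^ n‖ ≤ 1 := by
          rw [norm_pow, Complex.norm_real, Real.norm_of_nonneg ht.1.le]
          exact pow_le_one₀ ht.1.le ht.2
        rw [mul_pow, mul_left_comm (u n), norm_mul, norm_mul ((t : ℂ) ^ n)]
        calc _ ≤ 1 * (1 * ‖u n * z ^ n‖) := by gcongr
          _ = _ := by ring)
      (Filter.Eventually.of_forall fun t _ => hsum)
      intervalIntegrable_const
      (Filter.Eventually.of_forall fun t ht => by
        rw [Set.uIoc_of_le zero_le_one] at ht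
        refine (hH.2 _ ?_).mul_left _
        rw [norm_mul, Complex.norm_real, Real.norm_of_nonneg ht.1.le]
        calc t * ‖z‖ ≤ 1 * ‖z‖ := by gcongr; exact ht.2
          _ < 1 := by rwa [one_mul])
    refine HasSum.congr_fun h fun n => ?_
    have hre : 0 < (s + n).re := by
      simp only [Complex.add_re, Complex.natCast_re]
      positivity
    have hne : s + n + 1 ≠ 0 := fun h0 => by
      have := congrArg Complex.re h0
      simp only [Complex.add_re, Complex.one_re, Complex.zero_re] at this hre
      linarith
    have hi : ∫ t in (0 : ℝ)..1, (t : ℂ) ^ (s + n) = 1 / (s + n + 1) := by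
      rw [integral_cpow (Or.inl (by linarith))]
      simp [Complex.zero_cpow hne]
    have hcongr : ∫ t in (0 : ℝ)..1, (t : ℂ) ^ s * (u n * (t * z) ^ n) =
        ∫ t in (0 : ℝ)..1, u n * z ^ n * (t : ℂ) ^ (s + n) := by
      refine intervalIntegral.integral_congr_ae (Filter.Eventually.of_forall fun t ht => ?_)
      rw [Set.uIoc_of_le zero_le_one] at ht
      rw [Complex.cpow_add _ _ (Complex.ofReal_ne_zero.2 ht.1.ne'), Complex.cpow_natCast]
      ring
    beta_reduce
    rw [hcongr, intervalIntegral.integral_const_mul, hi, show (n : ℂ) + s + 1 = s + n + 1 by ring]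
    ring

/-- Division by `n + β`, stated without quotients so that `n + β = 0` is allowed. Removing `N`
Taylor terms makes the exponent `s = N + β - 1` have positive real part, and a polynomial restores
the first `N` values of `v`. -/
theorem HasExpansion.exists_of_mul_eq {u v : ℕ → ℂ} {F : ℂ → ℂ} (hF : HasExpansion u F) (β : ℂ)
    (h : ∀ n : ℕ, (n + β) * v n = u n) : ∃ G, HasExpansion v G := by
  obtain ⟨N, hN⟩ := exists_nat_gt (1 - β.re)
  obtain ⟨H, hH, -⟩ := hF.exists_tail N
  have hs : 0 < (N + β - 1 : ℂ).re := by
    simp only [Complex.add_re, Complex.sub_re, Complex.natCast_re, Complex.one_re]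
    linarith
  refine ⟨_, ((hasExpansion_polynomial N v).add ((hH.integral hs).pow_mul N)).congr_coeff
    fun n => ?_⟩
  rcases lt_or_ge n N with hn | hn
  · rw [if_pos hn, if_neg (not_le.2 hn), add_zero]
  · obtain ⟨k, rfl⟩ := Nat.exists_eq_add_of_le' hn
    rw [if_neg (not_lt.2 hn), if_pos hn, Nat.add_sub_cancel, zero_add, ← h]
    have hne : (k : ℂ) + (N + β - 1) + 1 ≠ 0 := fun h0 => by
      have h1 := congrArg Complex.re h0
      simp only [Complex.add_re, Complex.sub_re, Complex.natCast_re, Complex.one_re,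
        Complex.zero_re] at h1 hs
      have : (0 : ℝ) ≤ k := Nat.cast_nonneg k
      linarith
    rw [eq_div_iff hne]
    push_cast
    ring

/-- Pfaff's transformation on the level of Taylor coefficients. -/
theorem HasExpansion.pfaff {a : ℂ} {c : ℕ → ℂ} {F : ℂ → ℂ}
    (hF : HasExpansion (fun n => poch a n / (n ! : ℂ) * c n) F) :
    HasExpansion (fun j => poch a j / (j ! : ℂ) *
        ∑ n ∈ Finset.range (j + 1), (-1) ^ n * (j.choose n : ℂ) * c n)
      (fun y => (1 - y) ^ (-a) * F (y / (y - 1))) := by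
  have hne : ∀ y ∈ cutPlane, y - 1 ≠ 0 := fun y hy h0 =>
    one_sub_ne_zero_of_mem hy (by linear_combination -h0)
  have hcomp : ∀ G : ℂ → ℂ, DifferentiableOn ℂ G cutPlane →
      DifferentiableOn ℂ (fun y => G (y / (y - 1))) cutPlane := fun G hG =>
    hG.comp (differentiableOn_id.div (by fun_prop) hne) fun y hy => div_sub_one_mem hy
  have hD := (hasExpansion_binomial a).1.mul (hcomp F hF.1)
  have ht := hasExpansion_taylor hD
  refine cast (congrArg (fun u => HasExpansion u _) ?_) ht
  funext j
  -- The remainder contributes a multiple of `y^(j+1)`, invisible in the `j`-th coefficient. Only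
  -- finitely many terms `(1-y)^(-a) (y/(y-1))^n = (-1)^n y^n (1-y)^(-(a+n))` matter, so no
  -- interchange of infinite sums is needed.
  obtain ⟨H, hH, hFH⟩ := hF.exists_tail (j + 1)
  have hK : DifferentiableOn ℂ (fun y => (1 - y) ^ (-a) * ((y - 1)⁻¹ ^ (j + 1) * H (y / (y - 1))))
      cutPlane := by
    refine (hasExpansion_binomial a).1.mul (DifferentiableOn.mul ?_ (hcomp H hH.1))
    exact ((differentiableOn_id.sub_const 1).inv hne).pow _
  have h1 := HasExpansion.sum (Finset.range (j + 1)) fun n _ =>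
    (((hasExpansion_binomial (a + n)).pow_mul n).const_mul
      ((-1) ^ n * (poch a n / (n ! : ℂ) * c n)))
  have h2 := h1.add ((hasExpansion_taylor hK).pow_mul (j + 1))
  have h3 := congrFun (ht.unique (h2.congr fun y hy => by
    have hy0 := one_sub_ne_zero_of_mem hy
    have hy1 := hne y hy
    simp only [Pi.mul_apply]
    rw [hFH, mul_add, Finset.mul_sum]
    congr 1
    · refine Finset.sum_congr rfl fun n _ => ?_
      rw [neg_add, Complex.cpow_add _ _ hy0, Complex.cpow_neg _ (n : ℂ), Complex.cpow_natCast,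
        div_pow, ← neg_sub 1 y, neg_pow (1 - y)]
      have : ((-1 : ℂ) ^ n) * (-1) ^ n = 1 := by
        rw [← mul_pow]
        simp
      have h4 : ((-1 : ℂ) ^ n)⁻¹ = (-1) ^ n := inv_eq_of_mul_eq_one_left this
      rw [div_eq_mul_inv (y ^ n), mul_inv, h4]
      ring
    · rw [div_eq_mul_inv, mul_pow]
      ring)) j
  rw [h3, if_neg (by omega), add_zero, Finset.mul_sum]
  refine Finset.sum_congr rfl fun n hn => ?_
  have hnj : n ≤ j := Nat.lt_succ_iff.1 (Finset.mem_range.1 hn)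
  obtain ⟨k, rfl⟩ := Nat.exists_eq_add_of_le hnj
  rw [if_pos hnj, Nat.add_sub_cancel_left, Nat.cast_add_choose, poch_add]
  have hf1 : (n ! : ℂ) ≠ 0 := Nat.cast_ne_zero.2 n.factorial_ne_zero
  have hf2 : (k ! : ℂ) ≠ 0 := Nat.cast_ne_zero.2 k.factorial_ne_zero
  have hf3 : ((n + k)! : ℂ) ≠ 0 := Nat.cast_ne_zero.2 (n + k).factorial_ne_zero
  field_simp

/-- Convergence at `1/2` bounds `u n` by a multiple of `2^n`, which the factorial beats for every
`z`. -/
theorem HasExpansion.summable_div_factorial {u : ℕ → ℂ} {F : ℂ → ℂ} (hF : HasExpansion u F)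
    (z : ℂ) : Summable fun n => ‖u n / (n ! : ℂ) * z ^ n‖ := by
  have h := (hF.2 (1 / 2) (by norm_num)).summable.tendsto_atTop_zero
  obtain ⟨K, hK⟩ := (h.norm.bddAbove_range)
  refine Summable.of_nonneg_of_le (fun _ => norm_nonneg _) (fun n => ?_)
    ((Real.summable_pow_div_factorial (2 * ‖z‖)).mul_left K)
  have h1 : ‖u n * (1 / 2 : ℂ) ^ n‖ ≤ K := hK ⟨n, rfl⟩
  have h2 : ‖u n‖ = ‖u n * (1 / 2 : ℂ) ^ n‖ * 2 ^ n := by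
    rw [norm_mul, norm_pow, mul_assoc, ← mul_pow]
    norm_num
  rw [norm_mul, norm_div, Complex.norm_natCast, norm_pow, h2, mul_pow]
  calc _ = ‖u n * (1 / 2 : ℂ) ^ n‖ * (2 ^ n * ‖z‖ ^ n / n !) := by ring
    _ ≤ _ := by gcongr

theorem HasExpansion.isContinuation {A B : Multiset ℂ} {u : ℕ → ℂ} {F : ℂ → ℂ}
    (h : HasExpansion u F) (hu : ∀ z n, hypTerm A B z n = u n * z ^ n) :
    IsContinuation A B F :=
  ⟨h.1, fun z hz => (h.2 z hz).congr_fun fun n => hu z n⟩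

/-! ### The two hypergeometric series and the tail coefficients -/

section Parameters

variable {r : ℕ} (b : ℂ) (f : Fin r → ℂ) (m : Fin r → ℕ)

theorem prod_map_params (g : Fin r → ℂ) (n : ℕ) :
    ((params g).map fun α => poch α n).prod = ∏ j, poch (g j) n := by
  rw [params, Multiset.map_map]
  rfl

theorem prod_poch_shift_div (hf : ∀ j, ∀ n : ℕ, f j ≠ -(n : ℂ)) (n : ℕ) :
    (∏ j, poch (shift f m j) n) / ∏ j, poch (f j) n =
      vecPoch (fun j => f j + n) m / vecPoch f m := by
  have h1 : ∏ j, poch (f j) n ≠ 0 := Finset.prod_ne_zero_iff.2 fun j _ => poch_ne_zero (hf j) n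
  have h2 : vecPoch f m ≠ 0 := Finset.prod_ne_zero_iff.2 fun j _ => poch_ne_zero (hf j) (m j)
  rw [div_eq_div_iff h1 h2, vecPoch, vecPoch,
    ← Finset.prod_mul_distrib, ← Finset.prod_mul_distrib]
  refine Finset.prod_congr rfl fun j _ => ?_
  rw [shift, mul_comm, ← poch_add, add_comm, poch_add, mul_comm]

/-- The coefficient `(b)_n / (b + 2)_n · (f + m)_n / (f)_n`. -/
def ratioCoeff (n : ℕ) : ℂ :=
  poch b n / poch (b + 2) n * (vecPoch (fun j => f j + n) m / vecPoch f m)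

theorem hypTerm_two (hf : ∀ j, ∀ n : ℕ, f j ≠ -(n : ℂ)) (a z : ℂ) (n : ℕ) :
    hypTerm ({a, b} + params (shift f m)) ({b + 2} + params f) z n =
      poch a n / (n ! : ℂ) * ratioCoeff b f m n * z ^ n := by
  rw [ratioCoeff, ← prod_poch_shift_div f m hf, hypTerm, Multiset.map_add, Multiset.map_add,
    Multiset.prod_add, Multiset.prod_add, prod_map_params, prod_map_params]
  simp only [Multiset.insert_eq_cons, Multiset.map_cons, Multiset.map_singleton,
    Multiset.prod_cons, Multiset.prod_singleton]
  ring

theorem hypTerm_one (hf : ∀ j, ∀ n : ℕ, f j ≠ -(n : ℂ)) (z : ℂ) (n : ℕ) :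
    hypTerm ({b} + params (shift f m)) ({b + 2} + params f) z n =
      ratioCoeff b f m n / (n ! : ℂ) * z ^ n := by
  rw [ratioCoeff, ← prod_poch_shift_div f m hf, hypTerm, Multiset.map_add, Multiset.map_add,
    Multiset.prod_add, Multiset.prod_add, prod_map_params, prod_map_params]
  simp only [Multiset.map_singleton, Multiset.prod_singleton]
  ring

theorem hypTerm_one_three (α β γ δ z : ℂ) (n : ℕ) :
    hypTerm {1, α, γ} {β, δ} z n =
      poch γ n / poch δ n * (poch α n / poch β n) * z ^ n := by
  have hn : (n ! : ℂ) ≠ 0 := Nat.cast_ne_zero.2 n.factorial_ne_zero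
  rw [hypTerm]
  simp only [Multiset.insert_eq_cons, Multiset.map_cons, Multiset.map_singleton,
    Multiset.prod_cons, Multiset.prod_singleton, poch_one]
  field_simp

theorem hypTerm_one_two (β γ δ z : ℂ) (n : ℕ) :
    hypTerm {1, γ} {β, δ} z n = poch γ n / poch δ n * (1 / poch β n) * z ^ n := by
  have hn : (n ! : ℂ) ≠ 0 := Nat.cast_ne_zero.2 n.factorial_ne_zero
  rw [hypTerm]
  simp only [Multiset.insert_eq_cons, Multiset.map_cons, Multiset.map_singleton,
    Multiset.prod_cons, Multiset.prod_singleton, poch_one]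
  field_simp

/-- Formally `(b)_n/(b+2)_n = b(b+1)/((b+n)(b+n+1))`: two divisions applied to the binomial series,
then multiplication by the polynomial `(f+n)_m`. -/
theorem exists_hasExpansion_ratioCoeff (hb : ∀ n : ℕ, b + 2 ≠ -(n : ℂ)) (a : ℂ) :
    ∃ F, HasExpansion (fun n => poch a n / (n ! : ℂ) * ratioCoeff b f m n) F := by
  have h0 := (hasExpansion_binomial a).const_mul (b * (b + 1))
  obtain ⟨F₁, h1⟩ := h0.exists_of_mul_eq (b + 1)
    (v := fun n => (n + b) * (poch a n / (n ! : ℂ) * (poch b n / poch (b + 2) n))) (fun n => by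
      have e1 := poch_add b n 2
      have e2 := poch_add b 2 n
      rw [add_comm n 2, e2] at e1
      have e3 := poch_ne_zero hb n
      simp only [poch_succ, poch_zero, Nat.cast_one, Nat.cast_zero, Nat.cast_ofNat] at e1
      field_simp
      linear_combination -poch a n / (n ! : ℂ) * e1)
  obtain ⟨F₂, h2⟩ := h1.exists_of_mul_eq b
    (v := fun n => poch a n / (n ! : ℂ) * (poch b n / poch (b + 2) n)) (fun n => rfl)
  obtain ⟨F₃, h3⟩ := h2.exists_eval_mul
    (∏ i, (ascPochhammer ℂ (m i)).comp (Polynomial.C (f i) + Polynomial.X))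
  refine ⟨_, (h3.const_mul (vecPoch f m)⁻¹).congr_coeff fun n => ?_⟩
  rw [ratioCoeff, Polynomial.eval_prod]
  simp only [Polynomial.eval_comp, Polynomial.eval_add, Polynomial.eval_C, Polynomial.eval_X]
  rw [vecPoch]
  simp only [poch]
  ring

/-- By Chu–Vandermonde, `n!/(β)_n` is the binomial transform of `(β-1)_n/(β)_n`, so Pfaff yields
`(α)_n/(β)_n`; the remaining ratio is `(n+γ)/γ`. -/
theorem exists_hasExpansion_poch_div (α : ℂ) {β γ : ℂ} (hβ : ∀ n : ℕ, β ≠ -(n : ℂ))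
    (hγ : ∀ n : ℕ, γ ≠ -(n : ℂ)) :
    ∃ G, HasExpansion (fun n => poch (γ + 1) n / poch γ n * (poch α n / poch β n)) G := by
  obtain ⟨F, hF⟩ := ((hasExpansion_binomial α).const_mul (β - 1)).exists_of_mul_eq (β - 1)
    (v := fun n => poch α n / (n ! : ℂ) * (poch (β - 1) n / poch β n)) (fun n => by
      have e := poch_add_one_mul (β - 1) n
      rw [sub_add_cancel] at e
      have e3 := poch_ne_zero hβ n
      field_simp
      linear_combination -poch α n / (n ! : ℂ) * e)
  obtain ⟨G, hG⟩ := hF.pfaff.exists_eval_mul (Polynomial.X + Polynomial.C γ)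
  refine ⟨_, (hG.const_mul γ⁻¹).congr_coeff fun n => ?_⟩
  have hn : (n ! : ℂ) ≠ 0 := Nat.cast_ne_zero.2 n.factorial_ne_zero
  have hγ0 : γ ≠ 0 := by simpa using hγ 0
  have e1 := poch_add_one_mul γ n
  have e2 := poch_ne_zero hγ n
  rw [sum_choose_mul_poch_div n (β - 1) β hβ, show β - (β - 1) = 1 by ring, poch_one]
  have e3 : poch (γ + 1) n / poch γ n = γ⁻¹ * (n + γ) := by
    field_simp
    linear_combination e1
  rw [e3]
  simp only [Polynomial.eval_add, Polynomial.eval_C, Polynomial.eval_X]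
  field_simp

theorem mul_vecPoch_sub_one (hden : ∀ j, f j - b - 1 + m j ≠ 0) {lam : ℂ}
    (hlam : lam = 1 + b - b * (∏ j, (f j - b - 1)) / ∏ j, (f j - b - 1 + m j)) :
    b * vecPoch (fun j => f j - b - 1) m = vecPoch (fun j => f j - b) m * (1 + b - lam) := by
  have h0 : ∏ j, (f j - b - 1 + m j) ≠ 0 := Finset.prod_ne_zero_iff.2 fun j _ => hden j
  have h1 : vecPoch (fun j => f j - b) m * ∏ j, (f j - b - 1) =
      vecPoch (fun j => f j - b - 1) m * ∏ j, (f j - b - 1 + m j) := by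
    rw [vecPoch, vecPoch, ← Finset.prod_mul_distrib, ← Finset.prod_mul_distrib]
    refine Finset.prod_congr rfl fun j _ => ?_
    have := poch_add_one_mul (f j - b - 1) (m j)
    rwa [sub_add_cancel] at this
  rw [hlam]
  field_simp
  linear_combination -b * h1

theorem vecPoch_sub_ne_zero (hfb : ∀ j, ∀ i : ℕ, i + 2 ≤ m j → f j - b ≠ -(i : ℂ))
    (hden : ∀ j, f j - b - 1 + m j ≠ 0) : vecPoch (fun j => f j - b) m ≠ 0 := by
  refine Finset.prod_ne_zero_iff.2 fun j _ => poch_ne_zero_of_lt fun i hi h => ?_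
  rcases Nat.lt_or_ge (i + 1) (m j) with h1 | h1
  · exact hfb j i h1 h
  · have h2 : m j = i + 1 := by omega
    apply hden j
    have h3 : f j - b = -(i : ℂ) := h
    rw [h3, h2]
    push_cast
    ring

/-- The inner sum `∑_{k ≤ j} (-1)^k (b)_k (j - k + 1) C_{k,r}` restricted to `k ≤ m`. -/
def innerSum (j : ℕ) : ℂ :=
  ∑ k ∈ Finset.range (∑ i, m i + 1),
    if k ≤ j then (-1) ^ k * poch b k * ((j : ℂ) - k + 1) * coeffC f m k else 0

theorem innerSum_of_le {j : ℕ} (hj : j ≤ ∑ i, m i) :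
    innerSum b f m j =
      ∑ k ∈ Finset.range (j + 1), (-1) ^ k * poch b k * ((j : ℂ) - k + 1) * coeffC f m k := by
  rw [innerSum, ← Finset.sum_filter]
  refine Finset.sum_congr ?_ fun _ _ => rfl
  ext k
  simp only [Finset.mem_filter, Finset.mem_range]
  omega

theorem innerSum_of_ge {j : ℕ} (hj : ∑ i, m i ≤ j + 1) :
    innerSum b f m j =
      ((b + (j + 1)) * vecPoch (fun j => f j - b) m - b * vecPoch (fun j => f j - b - 1) m) /
        vecPoch f m := by
  have h := sum_coeffC_mul_linear b f m (-j)
  rw [show (1 : ℂ) - -j + b = b + (j + 1) by ring] at h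
  rw [← h, innerSum]
  refine Finset.sum_congr rfl fun k hk => ?_
  split_ifs with hkj
  · ring
  -- The only index that truncation can drop is `k = j + 1`, where the weight `j-k+1` vanishes;
  -- hence the formula already holds at `j = m - 1`.
  · have hk' : k = j + 1 := by
      simp only [Finset.mem_range] at hk
      omega
    rw [hk']
    push_cast
    ring

theorem innerSum_add (hf : ∀ j, ∀ n : ℕ, f j ≠ -(n : ℂ)) (hden : ∀ j, f j - b - 1 + m j ≠ 0)
    {lam : ℂ} (hlam : lam = 1 + b - b * (∏ j, (f j - b - 1)) / ∏ j, (f j - b - 1 + m j))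
    {N : ℕ} (hN : ∑ i, m i = N + 1) (hγ : ∀ n : ℕ, lam + N ≠ -(n : ℂ)) (i : ℕ) :
    innerSum b f m (i + N) =
      ((b + (N + 1)) * vecPoch (fun j => f j - b) m - b * vecPoch (fun j => f j - b - 1) m) /
        vecPoch f m * (poch (lam + N + 1) i / poch (lam + N) i) := by
  have e1 := poch_add_one_mul (lam + N) i
  have e2 := poch_ne_zero hγ i
  have e4 : vecPoch f m ≠ 0 := Finset.prod_ne_zero_iff.2 fun j _ => poch_ne_zero (hf j) (m j)
  rw [innerSum_of_ge b f m (by omega), mul_vecPoch_sub_one b f m hden hlam]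
  field_simp
  push_cast
  linear_combination -vecPoch (fun j => f j - b) m * e1

theorem sum_choose_mul_ratioCoeff (hb : ∀ n : ℕ, b + 2 ≠ -(n : ℂ)) (j : ℕ) :
    ∑ n ∈ Finset.range (j + 1), (-1) ^ n * (j.choose n : ℂ) * ratioCoeff b f m n =
      (j ! : ℂ) / poch (b + 2) j * innerSum b f m j :=
  sum_choose_mul_coeff b f m hb j

theorem reducedPoly_one_eq (hden : ∀ j, f j - b - 1 + m j ≠ 0) {lam : ℂ}
    (hlam : lam = 1 + b - b * (∏ j, (f j - b - 1)) / ∏ j, (f j - b - 1 + m j)) :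
    reducedPoly b f m 1 =
      Polynomial.C (-(vecPoch (fun j => f j - b) m / vecPoch f m)) *
        (Polynomial.X - Polynomial.C lam) := by
  refine Polynomial.funext fun t => ?_
  rw [eval_reducedPoly_one, mul_vecPoch_sub_one b f m hden hlam]
  simp only [Polynomial.eval_mul, Polynomial.eval_sub, Polynomial.eval_C, Polynomial.eval_X]
  ring

/-- Kummer's transformation: multiplication by `exp (-x)` acts on the coefficients as the binomial
transform. -/
theorem exp_neg_mul_tsum {c : ℕ → ℂ} {x : ℂ}
    (hc : Summable fun n => ‖c n / (n ! : ℂ) * x ^ n‖) :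
    HasSum (fun j => (-x) ^ j / (j ! : ℂ) *
        ∑ n ∈ Finset.range (j + 1), (-1) ^ n * (j.choose n : ℂ) * c n)
      (Complex.exp (-x) * ∑' n, c n / (n ! : ℂ) * x ^ n) := by
  have he : Summable fun n : ℕ => ‖(-x) ^ n / (n ! : ℂ)‖ :=
    NormedSpace.norm_expSeries_div_summable (-x)
  have h1 := hasSum_sum_range_mul_of_summable_norm hc he
  have h2 : ∑' n : ℕ, (-x) ^ n / (n ! : ℂ) = Complex.exp (-x) := by
    rw [Complex.exp_eq_exp_ℂ, NormedSpace.exp_eq_tsum_div]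
  rw [h2, mul_comm] at h1
  refine h1.congr_fun fun j => ?_
  rw [Finset.mul_sum]
  refine Finset.sum_congr rfl fun n hn => ?_
  obtain ⟨k, rfl⟩ := Nat.exists_eq_add_of_le (Nat.lt_succ_iff.1 (Finset.mem_range.1 hn))
  have hf1 : (n ! : ℂ) ≠ 0 := Nat.cast_ne_zero.2 n.factorial_ne_zero
  have hf2 : (k ! : ℂ) ≠ 0 := Nat.cast_ne_zero.2 k.factorial_ne_zero
  have hf3 : ((n + k)! : ℂ) ≠ 0 := Nat.cast_ne_zero.2 (n + k).factorial_ne_zero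
  rw [Nat.add_sub_cancel_left, Nat.cast_add_choose, pow_add, neg_pow x n]
  have h3 : ((-1 : ℂ) ^ n) * (-1) ^ n = 1 := by
    rw [← mul_pow]
    simp
  field_simp
  linear_combination (-1) ^ k * c n * x ^ n * x ^ k * h3

end Parameters

end GenHyp

end

/-! ### The main theorem -/

open GenHyp in
theorem corollary5 (r : ℕ) (hr : 1 ≤ r) (m : Fin r → ℕ) (hm : ∀ j, 1 ≤ m j)
    (M : ℕ) (hM : M = ∑ j, m j) (b : ℂ) (f : Fin r → ℂ)
    (hb : ∀ n : ℕ, b + 2 ≠ -(n : ℂ))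
    (hf : ∀ j, ∀ n : ℕ, f j ≠ -(n : ℂ))
    (hfb : ∀ j, ∀ i : ℕ, i + 2 ≤ m j → f j - b ≠ -(i : ℂ))
    (hden : ∀ j, f j - b - 1 + m j ≠ 0)
    (lam : ℂ) (hlam : lam = 1 + b - b * (∏ j, (f j - b - 1)) / ∏ j, (f j - b - 1 + m j)) :
    ((reducedPoly b f m 1).natDegree = 1 ∧
      ∀ t : ℂ, (reducedPoly b f m 1).IsRoot t ↔ t = lam) ∧
    ((∀ n : ℕ, lam + M - 1 ≠ -(n : ℂ)) →
      (∀ a : ℂ,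
        (∃ F, IsContinuation ({a, b} + params (shift f m)) ({b + 2} + params f) F) ∧
        (∃ G, IsContinuation {1, a + M - 1, lam + M} {b + M + 1, lam + M - 1} G) ∧
        ∀ x ∈ cutPlane,
          (1 - x) ^ a * hypCont ({a, b} + params (shift f m)) ({b + 2} + params f) x =
            (∑ j ∈ Finset.range (M - 1),
              poch a j / poch (b + 2) j * (x / (x - 1)) ^ j *
                ∑ k ∈ Finset.range (j + 1),
                  (-1) ^ k * poch b k * ((j : ℂ) - k + 1) * coeffC f m k) +
            x ^ (M - 1) * poch a (M - 1) *
                ((b + M) * vecPoch (fun j => f j - b) m - b * vecPoch (fun j => f j - b - 1) m) /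
              ((x - 1) ^ (M - 1) * poch (b + 2) (M - 1) * vecPoch f m) *
              hypCont {1, a + M - 1, lam + M} {b + M + 1, lam + M - 1} (x / (x - 1))) ∧
      (∀ x : ℂ,
        Summable (hypTerm ({b} + params (shift f m)) ({b + 2} + params f) x) ∧
        Summable (hypTerm {1, lam + M} {b + M + 1, lam + M - 1} (-x)) ∧
        Complex.exp (-x) * hypSum ({b} + params (shift f m)) ({b + 2} + params f) x =
          (∑ j ∈ Finset.range (M - 1),
            (-x) ^ j / poch (b + 2) j *
              ∑ k ∈ Finset.range (j + 1),
                (-1) ^ k * poch b k * ((j : ℂ) - k + 1) * coeffC f m k) +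
          (-x) ^ (M - 1) *
              ((b + M) * vecPoch (fun j => f j - b) m - b * vecPoch (fun j => f j - b - 1) m) /
            (poch (b + 2) (M - 1) * vecPoch f m) *
            hypSum {1, lam + M} {b + M + 1, lam + M - 1} (-x))) := by
  have hMpos : 1 ≤ M := by
    rw [hM]
    exact (hm ⟨0, hr⟩).trans (Finset.single_le_sum (f := m) (fun _ _ => Nat.zero_le _)
      (Finset.mem_univ _))
  have hA := vecPoch_sub_ne_zero b f m hfb hden
  have hD : vecPoch f m ≠ 0 := Finset.prod_ne_zero_iff.2 fun j _ => poch_ne_zero (hf j) (m j)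
  obtain ⟨N, rfl⟩ := Nat.exists_eq_add_of_le' hMpos
  refine ⟨?_, fun hγ' => ?_⟩
  · rw [reducedPoly_one_eq b f m hden hlam]
    have hne : -(vecPoch (fun j => f j - b) m / vecPoch f m) ≠ 0 := neg_ne_zero.2 (div_ne_zero hA hD)
    refine ⟨by rw [Polynomial.natDegree_C_mul hne, Polynomial.natDegree_X_sub_C], fun t => ?_⟩
    rw [Polynomial.IsRoot.def]
    simp only [Polynomial.eval_mul, Polynomial.eval_sub, Polynomial.eval_C, Polynomial.eval_X]
    rw [mul_eq_zero, or_iff_right hne, sub_eq_zero]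
  have hγ : ∀ n : ℕ, lam + N ≠ -(n : ℂ) := fun n h => hγ' n (by
    push_cast
    linear_combination h)
  have hβ : ∀ n : ℕ, b + N + 2 ≠ -(n : ℂ) := fun n h => hb (n + N) (by
    push_cast
    linear_combination h)
  have e1 : lam + ((N + 1 : ℕ) : ℂ) - 1 = lam + N := by push_cast; ring
  have e2 : lam + ((N + 1 : ℕ) : ℂ) = lam + N + 1 := by push_cast; ring
  have e3 : b + ((N + 1 : ℕ) : ℂ) + 1 = b + N + 2 := by push_cast; ring
  have e5 : b + ((N + 1 : ℕ) : ℂ) = b + (N + 1) := by push_cast; ring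
  have e6 : b + 2 + (N : ℂ) = b + N + 2 := by ring
  rw [e1, e2, e3, e5, Nat.add_sub_cancel]
  set K : ℂ := (b + (N + 1)) * vecPoch (fun j => f j - b) m -
    b * vecPoch (fun j => f j - b - 1) m with hK
  have htail := innerSum_add b f m hf hden hlam hM.symm hγ
  rw [← hK] at htail
  have hhead : ∀ j < N, innerSum b f m j =
      ∑ k ∈ Finset.range (j + 1), (-1) ^ k * poch b k * ((j : ℂ) - k + 1) * coeffC f m k :=
    fun j hj => innerSum_of_le b f m (by omega)
  refine ⟨fun a => ?_, fun x => ?_⟩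
  · have e4 : a + ((N + 1 : ℕ) : ℂ) - 1 = a + N := by push_cast; ring
    rw [e4]
    obtain ⟨F, hF⟩ := exists_hasExpansion_ratioCoeff b f m hb a
    obtain ⟨G, hG⟩ := exists_hasExpansion_poch_div (a + N) hβ hγ
    have hFc := hF.isContinuation (hypTerm_two b f m hf a)
    have hGc := hG.isContinuation
      (hypTerm_one_three (a + N) (b + N + 2) (lam + N + 1) (lam + N))
    refine ⟨⟨F, hFc⟩, ⟨G, hGc⟩, fun x hx => ?_⟩
    rw [hypCont_eq hFc hx, hypCont_eq hGc (div_sub_one_mem hx)]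
    have hL := hF.pfaff
    have hR := ((hasExpansion_polynomial N fun j => poch a j / poch (b + 2) j *
      ∑ k ∈ Finset.range (j + 1), (-1) ^ k * poch b k * ((j : ℂ) - k + 1) * coeffC f m k).add
      ((hG.pow_mul N).const_mul
        (poch a N * K / (poch (b + 2) N * vecPoch f m)))).congr_coeff
      (v := fun j => poch a j / (j ! : ℂ) * ∑ n ∈ Finset.range (j + 1),
        (-1) ^ n * (j.choose n : ℂ) * ratioCoeff b f m n) (fun j => by
        have hj : (j ! : ℂ) ≠ 0 := Nat.cast_ne_zero.2 j.factorial_ne_zero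
        rw [sum_choose_mul_ratioCoeff b f m hb, ← mul_assoc, div_mul_div_cancel₀ hj]
        rcases lt_or_ge j N with h | h
        · rw [if_pos h, if_neg (not_le.2 h), mul_zero, add_zero, hhead j h]
        · obtain ⟨i, rfl⟩ := Nat.exists_eq_add_of_le' h
          rw [if_neg (not_lt.2 h), if_pos h, zero_add, Nat.add_sub_cancel, htail, add_comm i N,
            poch_add, poch_add, e6]
          ring)
    have hx1 := one_sub_ne_zero_of_mem hx
    -- At `y = x/(x-1)` the involution returns `F x`, and `1 - y = (1-x)⁻¹` turns `(1-y)^(-a)` into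
    -- `(1-x)^a`; the principal branch is respected because `arg (1-x) ≠ π`.
    have hy := hL.eqOn hR (div_sub_one_mem hx)
    beta_reduce at hy
    have harg := (Complex.mem_slitPlane_iff_arg.1 ((mem_cutPlane_iff x).1 hx)).1
    rw [div_sub_one_invol hx, one_sub_div_sub_one hx, Complex.inv_cpow _ _ harg, Complex.cpow_neg,
      inv_inv] at hy
    rw [hy]
    congr 1
    · exact Finset.sum_congr rfl fun j _ => by ring
    · rw [div_pow]
      ring
  -- With upper parameter 1 the factor `(1)_n/n!` is trivial; these expansions serve only to bound
  -- the coefficients.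
  · obtain ⟨F, hF⟩ := exists_hasExpansion_ratioCoeff b f m hb 1
    obtain ⟨G, hG⟩ := exists_hasExpansion_poch_div 1 hβ hγ
    have hsF : Summable fun n => ‖ratioCoeff b f m n / (n ! : ℂ) * x ^ n‖ := by
      refine (hF.summable_div_factorial x).congr fun n => ?_
      rw [poch_one, div_self (Nat.cast_ne_zero.2 n.factorial_ne_zero), one_mul]
    have hsG : Summable (hypTerm {1, lam + N + 1} {b + N + 2, lam + N} (-x)) := by
      refine (hG.summable_div_factorial (-x)).of_norm.congr fun n => ?_
      have hn : (n ! : ℂ) ≠ 0 := Nat.cast_ne_zero.2 n.factorial_ne_zero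
      rw [hypTerm_one_two, poch_one]
      field_simp
    have hFeq : hypTerm ({b} + params (shift f m)) ({b + 2} + params f) x =
        fun n => ratioCoeff b f m n / (n ! : ℂ) * x ^ n := funext fun n => hypTerm_one b f m hf x n
    refine ⟨by rw [hFeq]; exact hsF.of_norm, hsG, ?_⟩
    have h := exp_neg_mul_tsum hsF
    rw [hypSum, hFeq, ← h.tsum_eq, ← h.summable.sum_add_tsum_nat_add N, hypSum, ← tsum_mul_left]
    congr 1
    · refine Finset.sum_congr rfl fun j hj => ?_
      have hn : (j ! : ℂ) ≠ 0 := Nat.cast_ne_zero.2 j.factorial_ne_zero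
      rw [sum_choose_mul_ratioCoeff b f m hb, hhead j (Finset.mem_range.1 hj), ← mul_assoc,
        div_mul_div_cancel₀ hn]
    · refine tsum_congr fun i => ?_
      have hn : ((i + N)! : ℂ) ≠ 0 := Nat.cast_ne_zero.2 (i + N).factorial_ne_zero
      rw [sum_choose_mul_ratioCoeff b f m hb, ← mul_assoc, div_mul_div_cancel₀ hn, htail,
        hypTerm_one_two, add_comm i N, poch_add, e6, pow_add]
      ring
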